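/- There is a universal constant $\delta>0$ such that the following holds for all sufficiently large $n\in\mathbb{N}$. If $\mathcal{H}$ is any collection of graphs on the vertex set $[n]$ with $$\sum_{H\in\mathcal{H}}\exp\left(-\frac{\delta\, e(H)}{\sqrt{n}}\right)<\frac12,$$ where $e(H)$ denotes the number of edges of $H$, then there is a triangle-free graph $G$ on $[n]$ that shares at least one edge with every $H\in\mathcal{H}$. Equivalently, the expectation-threshold $q(\mathcal{T}_n)$ of the family $\mathcal{T}_n$ of triangle-free graphs on $[n]$ satisfies $q(\mathcal{T}_n)=\Omega(1/\sqrt n)$: there is a universal constant $c>0$ such that $q(\mathcal{T}_n)\ge c/\sqrt n$ for all sufficiently large $n$. Here graphs on $[n]$ are identified with subsets of the set $X$ of all $\binom n2$ pairs of vertices, and, for a down-set $\mathcal{F}\subset 2^X$ with $X\notin\mathcal F$, $q(\mathcal{F})$ is the smallest $p\in[0,1]$ for which there is a family $\mathcal{G}\subset 2^X$ such that every member of $\mathcal{F}$ is contained in some member of $\mathcal{G}$ and $\sum_{S\in\mathcal{G}}(1-p)^{|X\setminus S|}\le \frac12$. -/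

import Mathlib

/-- The number `e(H)` of edges of a graph `H` on `[n]`. -/
noncomputable def edgeCount {n : ℕ} (H : SimpleGraph (Fin n)) : ℕ := H.edgeSet.ncard

/-- A family `F` of subsets of a finite set `X` (used for down-sets `F`) is `p`-small if there is a
certificate `G ⊆ 2^X` such that every member of `F` is contained in a member of `G` and
`∑_{S ∈ G} (1 - p)^{|X \ S|} ≤ 1/2`. -/
def IsDownSmall {X : Type*} [Fintype X] [DecidableEq X] (F : Set (Finset X)) (p : ℝ) : Prop :=
  ∃ G : Finset (Finset X), (∀ S ∈ F, ∃ T ∈ G, S ⊆ T) ∧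
    ∑ S ∈ G, (1 - p) ^ (Sᶜ).card ≤ 1 / 2

/-- The expectation-threshold `q(F)` of a down-set `F ⊆ 2^X`: the smallest `p ∈ [0,1]` for which
`F` is `p`-small. -/
noncomputable def downExpectationThreshold {X : Type*} [Fintype X] [DecidableEq X]
    (F : Set (Finset X)) : ℝ :=
  sInf {p : ℝ | p ∈ Set.Icc (0 : ℝ) 1 ∧ IsDownSmall F p}

/-- The infimum in the definition is a minimum as soon as `X ∉ F` (so for each
down-set `F ≠ 2^X`). -/
theorem isLeast_downExpectationThreshold {X : Type*} [Fintype X] [DecidableEq X]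
    (F : Set (Finset X)) (hF : Finset.univ ∉ F) :
    IsLeast {p : ℝ | p ∈ Set.Icc (0 : ℝ) 1 ∧ IsDownSmall F p} (downExpectationThreshold F) := by
  classical
  have hclosed : IsClosed {p : ℝ | p ∈ Set.Icc (0 : ℝ) 1 ∧ IsDownSmall F p} := by
    have h1 : {p : ℝ | IsDownSmall F p} =
        ⋃ G ∈ {G : Finset (Finset X) | ∀ S ∈ F, ∃ T ∈ G, S ⊆ T},
          {p : ℝ | ∑ S ∈ G, (1 - p) ^ (Sᶜ).card ≤ 1 / 2} := by
      ext p
      simp [IsDownSmall]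
    have h2 : IsClosed {p : ℝ | IsDownSmall F p} := by
      rw [h1]
      refine Set.Finite.isClosed_biUnion (Set.toFinite _) fun G _ => ?_
      exact isClosed_le (by fun_prop) continuous_const
    exact isClosed_Icc.inter h2
  refine hclosed.isLeast_csInf ⟨1, ⟨by norm_num, le_rfl⟩, ?_⟩ ⟨0, fun p hp => hp.1.1⟩
  refine ⟨Finset.univ.filter (· ∈ F), fun S hS => ⟨S, by simpa using hS, subset_rfl⟩, ?_⟩
  rw [Finset.sum_eq_zero]
  · norm_num
  · intro S hS
    have hS' : S ∈ F := by simpa using hS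
    have hne : S ≠ Finset.univ := fun h => hF (h ▸ hS')
    have : (Sᶜ).card ≠ 0 := by
      simpa [Finset.card_eq_zero] using hne
    simp [this]

/-- The edge set of the complete graph on `[n]`: the unordered pairs of distinct vertices. -/
abbrev CompleteEdge (n : ℕ) : Type := {e : Sym2 (Fin n) // ¬ e.IsDiag}

/-- The family `T_n` of (edge sets of) triangle-free graphs on `[n]`, as a family of subsets of the
edge set of the complete graph. -/
def triangleFreeFamily (n : ℕ) : Set (Finset (CompleteEdge n)) :=
  {S | (SimpleGraph.fromEdgeSet
      {e : Sym2 (Fin n) | ∃ h : ¬ e.IsDiag, (⟨e, h⟩ : CompleteEdge n) ∈ S}).CliqueFree 3}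

/-- `T_n` is a down-set. -/
theorem isLowerSet_triangleFreeFamily (n : ℕ) : IsLowerSet (triangleFreeFamily n) := by
  intro S T hTS hS
  refine SimpleGraph.CliqueFree.anti (SimpleGraph.fromEdgeSet_mono ?_) hS
  rintro e ⟨h, he⟩
  exact ⟨h, hTS he⟩

open Finset

/-! Take a random edge set S with density p = 1/(16√n) and delete a maximal edge-disjoint family of
the triangles in S. What remains is triangle-free, by maximality. A set H is still hit if |S ∩ H|
exceeds three times the number of deleted triangles meeting H. This can fail only if |S ∩ H| ≤
p|H|/4 (`sum_bernoulliWeight_inter_small_le`) or S contains about p|H|/16 disjoint triangles meeting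
H. At most n|H| triangles meet H and np² = 1/256, so a union bound over disjoint families
(`sum_bernoulliWeight_disjoint_triples_le`) makes the second event as rare as the first. Summing
over H leaves a good S. Only 3-uniformity and maximum degree at most n matter
(`exists_independent_hitting`). The threshold bound is the dual form, with H the complement of a
certificate set. -/

/-- The probability that a `p`-random subset of `X` equals `S`. -/
noncomputable def bernoulliWeight {X : Type*} [Fintype X] [DecidableEq X] (p : ℝ)
    (S : Finset X) : ℝ :=
  p ^ S.card * (1 - p) ^ (Sᶜ).card

/-! ### Probability estimates for a random subset -/

section RandomSubset

variable {X : Type*} [Fintype X] [DecidableEq X] {p : ℝ}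

theorem bernoulliWeight_nonneg (hp : 0 ≤ p) (hp1 : p ≤ 1) (S : Finset X) :
    0 ≤ bernoulliWeight p S :=
  mul_nonneg (pow_nonneg hp _) (pow_nonneg (by linarith) _)

theorem sum_bernoulliWeight (p : ℝ) : ∑ S : Finset X, bernoulliWeight p S = 1 := by
  have h := Finset.prod_add (fun _ : X => p) (fun _ => 1 - p) univ
  simp only [prod_const, Finset.powerset_univ, ← compl_eq_univ_sdiff] at h
  simpa [bernoulliWeight] using h.symm

/-- A `p`-random set contains `A` with probability `p ^ |A|`. -/
theorem sum_bernoulliWeight_superset (p : ℝ) (A : Finset X) :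
    ∑ S : Finset X with A ⊆ S, bernoulliWeight p S = p ^ A.card := by
  have h := Finset.prod_add (fun _ : X => p) (fun x => if x ∈ A then 0 else 1 - p) univ
  simp only [Finset.powerset_univ, ← compl_eq_univ_sdiff] at h
  have hl : ∏ x : X, (p + if x ∈ A then 0 else 1 - p) = p ^ A.card := by
    have : ∀ x : X, (p + if x ∈ A then 0 else 1 - p) = if x ∈ A then p else 1 := by
      intro x; split_ifs <;> ring
    rw [prod_congr rfl fun x _ => this x]
    simp
  rw [← hl, h, Finset.sum_filter]
  refine sum_congr rfl fun S _ => ?_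
  split_ifs with hAS
  · have : ∀ x ∈ Sᶜ, (if x ∈ A then 0 else 1 - p) = 1 - p := fun x hx =>
      if_neg fun hxA => (mem_compl.1 hx) (hAS hxA)
    rw [prod_congr rfl this]
    simp [bernoulliWeight]
  · obtain ⟨x, hxA, hxS⟩ := Finset.not_subset.1 hAS
    rw [Finset.prod_eq_zero (f := fun x => if x ∈ A then 0 else 1 - p) (mem_compl.2 hxS) (if_pos hxA),
      mul_zero]

/-- The generating function of |S ∩ H| at 1/2, for the exponential Markov bound on the lower tail.
-/
theorem sum_bernoulliWeight_mul_half_pow (p : ℝ) (H : Finset X) :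
    ∑ S : Finset X, bernoulliWeight p S * (1 / 2) ^ (S ∩ H).card = (1 - p / 2) ^ H.card := by
  have h := Finset.prod_add (fun x : X => p * if x ∈ H then 1 / 2 else 1) (fun _ => 1 - p) univ
  simp only [Finset.powerset_univ, ← compl_eq_univ_sdiff] at h
  have hl : ∏ x : X, ((p * if x ∈ H then 1 / 2 else 1) + (1 - p)) = (1 - p / 2) ^ H.card := by
    have : ∀ x : X, ((p * if x ∈ H then 1 / 2 else 1) + (1 - p)) =
        if x ∈ H then 1 - p / 2 else 1 := by
      intro x; split_ifs <;> ring
    rw [prod_congr rfl fun x _ => this x]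
    simp
  rw [← hl, h]
  refine sum_congr rfl fun S _ => ?_
  rw [prod_mul_distrib, Finset.prod_ite]
  simp only [prod_const, one_pow, mul_one, bernoulliWeight, Finset.filter_mem_eq_inter]
  ring

/-- Lower tail bound for the size of the intersection of a `p`-random set with `H`. -/
theorem sum_bernoulliWeight_inter_small_le (hp : 0 ≤ p) (hp1 : p ≤ 1) (H : Finset X) :
    ∑ S : Finset X with ((S ∩ H).card : ℝ) ≤ p * H.card / 4, bernoulliWeight p S ≤
      Real.exp (-(p * H.card / 16)) := by
  set t : ℝ := p * H.card / 4 with ht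
  have ht0 : 0 ≤ t := by positivity
  have hpow : ∀ m : ℕ, ((1 : ℝ) / 2) ^ m = Real.exp (-(Real.log 2 * m)) := by
    intro m
    rw [← Real.exp_log (show (0 : ℝ) < (1 / 2) ^ m by positivity), Real.log_pow, one_div,
      Real.log_inv]
    ring_nf
  have hlog : 0 ≤ Real.log 2 := Real.log_nonneg (by norm_num)
  have h1 : Real.exp (-(Real.log 2 * t)) *
      ∑ S : Finset X with ((S ∩ H).card : ℝ) ≤ t, bernoulliWeight p S ≤ (1 - p / 2) ^ H.card := by
    rw [← sum_bernoulliWeight_mul_half_pow, mul_sum]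
    refine le_trans (sum_le_sum fun S hS => ?_) (sum_le_sum_of_subset_of_nonneg
      (filter_subset _ _) fun S _ _ => mul_nonneg (bernoulliWeight_nonneg hp hp1 S) (by positivity))
    rw [mul_comm, hpow]
    refine mul_le_mul_of_nonneg_left (Real.exp_le_exp.2 ?_) (bernoulliWeight_nonneg hp hp1 S)
    have := mul_le_mul_of_nonneg_left (mem_filter.1 hS).2 hlog
    linarith
  have h2 : (1 - p / 2) ^ H.card ≤ Real.exp (-(2 * t)) := by
    calc (1 - p / 2) ^ H.card ≤ (Real.exp (-(p / 2))) ^ H.card :=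
          pow_le_pow_left₀ (by linarith) (Real.one_sub_le_exp_neg _) _
      _ = Real.exp (-(2 * t)) := by rw [← Real.exp_nat_mul, ht]; ring_nf
  have h3 : ∑ S : Finset X with ((S ∩ H).card : ℝ) ≤ t, bernoulliWeight p S ≤
      Real.exp (Real.log 2 * t) * Real.exp (-(2 * t)) := by
    refine le_of_mul_le_mul_left ?_ (Real.exp_pos (-(Real.log 2 * t)))
    rw [← mul_assoc, ← Real.exp_add, neg_add_cancel, Real.exp_zero, one_mul]
    exact h1.trans h2
  refine h3.trans ?_
  rw [← Real.exp_add, Real.exp_le_exp]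
  have : Real.log 2 * t ≤ 1 * t := mul_le_mul_of_nonneg_right (by linarith [Real.log_two_lt_d9]) ht0
  linarith

theorem sum_biUnion_le {ι α : Type*} [DecidableEq α] {f : α → ℝ} (hf : ∀ a, 0 ≤ f a)
    (s : Finset ι) (t : ι → Finset α) : ∑ a ∈ s.biUnion t, f a ≤ ∑ i ∈ s, ∑ a ∈ t i, f a := by
  rw [← sum_sigma s t fun x => f x.2, ← sum_fiberwise_of_maps_to (t := s.biUnion t) (g := Sigma.snd)
    fun x hx => mem_biUnion.2 ⟨x.1, mem_sigma.1 hx⟩]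
  refine sum_le_sum fun a ha => ?_
  obtain ⟨i, hi, ha⟩ := mem_biUnion.1 ha
  exact single_le_sum (f := fun x : (_ : ι) × α => f x.2) (fun x _ => hf x.2)
    (mem_filter.2 ⟨mem_sigma.2 ⟨hi, ha⟩, rfl⟩ : (⟨i, a⟩ : (_ : ι) × α) ∈
      (s.sigma t).filter fun x => x.2 = a)

open scoped Classical in
/-- The probability that a `p`-random set contains `K` pairwise disjoint members of a family of
three-element sets. -/
theorem sum_bernoulliWeight_disjoint_triples_le (hp : 0 ≤ p) (hp1 : p ≤ 1)
    (T : Finset (Finset X)) (hT : ∀ A ∈ T, A.card = 3) (K : ℕ) :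
    ∑ S : Finset X with ∃ F ⊆ T, F.card = K ∧ (F : Set (Finset X)).PairwiseDisjoint id ∧
        ∀ A ∈ F, A ⊆ S, bernoulliWeight p S ≤ (T.card * p ^ 3) ^ K / K.factorial := by
  set 𝓕 : Finset (Finset (Finset X)) := (T.powersetCard K).filter fun F : Finset (Finset X) => (F : Set (Finset X)).PairwiseDisjoint id
  have hsub : (univ.filter fun S : Finset X => ∃ F ⊆ T, F.card = K ∧
      (F : Set (Finset X)).PairwiseDisjoint id ∧ ∀ A ∈ F, A ⊆ S) ⊆
      𝓕.biUnion fun F : Finset (Finset X) => univ.filter fun S : Finset X => F.biUnion id ⊆ S := by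
    intro S hS
    obtain ⟨F, hFT, hFK, hFd, hFS⟩ := (mem_filter.1 hS).2
    refine mem_biUnion.2 ⟨F, ?_, ?_⟩
    · simp [𝓕, mem_powersetCard, hFT, hFK, hFd]
    · simpa [Finset.biUnion_subset] using hFS
  calc _ ≤ ∑ S ∈ 𝓕.biUnion fun F : Finset (Finset X) => univ.filter fun S : Finset X => F.biUnion id ⊆ S,
          bernoulliWeight p S :=
        sum_le_sum_of_subset_of_nonneg hsub fun S _ _ => bernoulliWeight_nonneg hp hp1 S
    _ ≤ ∑ F ∈ 𝓕, ∑ S : Finset X with F.biUnion id ⊆ S, bernoulliWeight p S :=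
        sum_biUnion_le (bernoulliWeight_nonneg hp hp1) _ _
    -- Disjointness makes the union of F have exactly 3K elements.
    _ = ∑ F ∈ 𝓕, p ^ (3 * K) := by
        refine sum_congr rfl fun F hF => ?_
        obtain ⟨hF1, hF2⟩ := mem_filter.1 hF
        obtain ⟨hFT, hFK⟩ := mem_powersetCard.1 hF1
        rw [sum_bernoulliWeight_superset, card_biUnion hF2]
        rw [sum_congr rfl fun A hA => show (id A).card = 3 from hT A (hFT hA), sum_const, hFK, smul_eq_mul, mul_comm]
    _ = 𝓕.card * p ^ (3 * K) := by simp
    _ ≤ (T.card.choose K : ℝ) * p ^ (3 * K) := by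
        gcongr
        rw [← card_powersetCard]
        exact card_le_card (filter_subset _ _)
    _ ≤ ((T.card : ℝ) ^ K / K.factorial) * p ^ (3 * K) := by
        gcongr
        exact Nat.choose_le_pow_div _ _
    _ = _ := by rw [mul_pow, ← pow_mul]; ring

end RandomSubset

/-- For `p = 1 / (16 √n)`, a `p`-random set is unlikely to contain many disjoint members of a family
of triples that each meet `H`. -/
theorem mul_pow_div_factorial_le {n h m K : ℕ} {p : ℝ} (hp : 0 < p) (hnp : (n : ℝ) * p ^ 2 = 1 / 256)
    (hm : m ≤ h * n) (hK : p * h / 16 ≤ K) :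
    ((m : ℝ) * p ^ 3) ^ K / K.factorial ≤ Real.exp (-(p * h / 16)) := by
  rcases Nat.eq_zero_or_pos K with rfl | hK0
  · have : p * h / 16 ≤ 0 := by simpa using hK
    simpa using this
  have hK' : (0 : ℝ) < K := by exact_mod_cast hK0
  have hexp : Real.exp 1 * Real.exp 1 ≤ 16 := by
    nlinarith [Real.exp_one_lt_d9, Real.exp_pos 1]
  have hmean : (m : ℝ) * p ^ 3 ≤ K / 16 := by
    have hm' : (m : ℝ) ≤ h * n := by exact_mod_cast hm
    calc (m : ℝ) * p ^ 3 ≤ (h * n) * p ^ 3 := by gcongr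
      _ = p * h * (n * p ^ 2) := by ring
      _ ≤ K / 16 := by rw [hnp]; linarith
  -- One factor e⁻¹ absorbs K^K / K! ≤ e^K; the other supplies the decay e^(-K).
  have hbase : (m : ℝ) * p ^ 3 ≤ Real.exp (-1) * Real.exp (-1) * K := by
    refine hmean.trans ?_
    have : (1 : ℝ) / 16 ≤ Real.exp (-1) * Real.exp (-1) := by
      rw [Real.exp_neg, ← mul_inv, one_div]
      exact inv_anti₀ (by positivity) hexp
    nlinarith
  calc ((m : ℝ) * p ^ 3) ^ K / K.factorial
      ≤ (Real.exp (-1) * Real.exp (-1) * K) ^ K / K.factorial := by gcongr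
    _ = Real.exp (-K) * Real.exp (-K) * ((K : ℝ) ^ K / K.factorial) := by
        rw [mul_pow, mul_pow, ← Real.exp_nat_mul]; ring_nf
    _ ≤ Real.exp (-K) * Real.exp (-K) * Real.exp K := by
        gcongr
        exact Real.pow_div_factorial_le_exp _ hK'.le _
    _ = Real.exp (-K) := by rw [mul_assoc, ← Real.exp_add, neg_add_cancel, Real.exp_zero, mul_one]
    _ ≤ Real.exp (-(p * h / 16)) := Real.exp_le_exp.2 (by linarith)

/-! ### Independent sets in 3-uniform hypergraphs -/

section Triples

variable {X : Type*} [DecidableEq X]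

/-- Deleting a maximal disjoint subfamily of the triples contained in `S` leaves a set that contains
no triple; it still meets each `H` which meets `S` in many points but meets few disjoint triples. -/
theorem exists_independent_subset_hitting (T : Finset (Finset X)) (hT : ∀ A ∈ T, A.card = 3)
    (S : Finset X) (𝓗 : Finset (Finset X)) (K : Finset X → ℕ)
    (hlarge : ∀ H ∈ 𝓗, 3 * (K H - 1) < (S ∩ H).card)
    (hfew : ∀ H ∈ 𝓗, ¬ ∃ F ⊆ T.filter fun A => (A ∩ H).Nonempty, F.card = K H ∧
      (F : Set (Finset X)).PairwiseDisjoint id ∧ ∀ A ∈ F, A ⊆ S) :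
    ∃ S' ⊆ S, (∀ A ∈ T, ¬ A ⊆ S') ∧ ∀ H ∈ 𝓗, (S' ∩ H).Nonempty := by
  classical
  set 𝓒 : Finset (Finset (Finset X)) := T.powerset.filter fun F =>
    (F : Set (Finset X)).PairwiseDisjoint id ∧ ∀ A ∈ F, A ⊆ S with h𝓒
  obtain ⟨F, hF⟩ := 𝓒.exists_maximal ⟨∅, by simp [h𝓒]⟩
  obtain ⟨hF𝓒, hFmax⟩ := hF
  obtain ⟨hFT, hFd, hFS⟩ : F ⊆ T ∧ (F : Set (Finset X)).PairwiseDisjoint id ∧ ∀ A ∈ F, A ⊆ S := by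
    simpa [h𝓒] using hF𝓒
  refine ⟨S \ F.biUnion id, sdiff_subset, fun A hA hAS => ?_, fun H hH => ?_⟩
  · obtain ⟨hAS, hAF⟩ := subset_sdiff.1 hAS
    have hAF' : ∀ B ∈ F, Disjoint A B := fun B hB =>
      hAF.mono_right (Finset.subset_biUnion_of_mem id hB)
    have hins : insert A F ∈ 𝓒 := by
      refine mem_filter.2 ⟨mem_powerset.2 (insert_subset hA hFT), ?_, ?_⟩
      · rw [coe_insert]
        exact hFd.insert fun B hB _ => hAF' B hB
      · simpa using ⟨hAS, hFS⟩
    -- Maximality forces A into F, so A is disjoint from itself, hence empty.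
    have hmem : A ∈ F := hFmax hins (subset_insert A F) (mem_insert_self A F)
    have hempty : A = ∅ := by simpa using hAF' A hmem
    simpa [hempty] using hT A hA
  · set FH := F.filter fun A => (A ∩ H).Nonempty with hFH
    have hcard : FH.card ≤ K H - 1 := by
      by_contra! hlt
      obtain ⟨F', hF', hF'K⟩ := exists_subset_card_eq (show K H ≤ FH.card by omega)
      have hF'F : F' ⊆ F := hF'.trans (filter_subset _ _)
      exact hfew H hH ⟨F', hF'.trans (filter_subset_filter _ hFT), hF'K,
        hFd.subset (by exact_mod_cast hF'F), fun A hA => hFS A (hF'F hA)⟩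
    have hcover : S ∩ H ⊆ ((S \ F.biUnion id) ∩ H) ∪ FH.biUnion id := by
      intro x hx
      obtain ⟨hxS, hxH⟩ := mem_inter.1 hx
      by_cases hxF : x ∈ F.biUnion id
      · obtain ⟨A, hA, hxA⟩ := mem_biUnion.1 hxF
        exact mem_union_right _ (mem_biUnion.2
          ⟨A, mem_filter.2 ⟨hA, x, mem_inter.2 ⟨hxA, hxH⟩⟩, hxA⟩)
      · exact mem_union_left _ (mem_inter.2 ⟨mem_sdiff.2 ⟨hxS, hxF⟩, hxH⟩)
    have h1 := (card_le_card hcover).trans (card_union_le _ _)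
    have h2 : (FH.biUnion id).card ≤ FH.card * 3 := card_biUnion_le_card_mul _ _ _ fun A hA =>
      (hT A (hFT (filter_subset _ _ hA))).le
    have h3 := hlarge H hH
    exact card_pos.1 (by omega)

/-- Each triple meeting H is counted at some point of H, and each point has degree at most n. -/
theorem card_filter_meeting_le (T : Finset (Finset X)) {n : ℕ}
    (hdeg : ∀ x, (T.filter fun A => x ∈ A).card ≤ n) (H : Finset X) :
    (T.filter fun A => (A ∩ H).Nonempty).card ≤ H.card * n := by
  refine le_trans (card_le_card fun A hA => ?_)
    (card_biUnion_le_card_mul H (fun x => T.filter fun A => x ∈ A) n fun x _ => hdeg x)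
  obtain ⟨hAT, x, hx⟩ := mem_filter.1 hA
  obtain ⟨hxA, hxH⟩ := mem_inter.1 hx
  exact mem_biUnion.2 ⟨x, hxH, mem_filter.2 ⟨hAT, hxA⟩⟩

/-- In a `3`-uniform hypergraph of maximum degree at most `n`, each sufficiently sparse collection
of sets is hit by some independent set. -/
theorem exists_independent_hitting [Fintype X] {n : ℕ} (hn : 1 ≤ n) (T : Finset (Finset X))
    (hT : ∀ A ∈ T, A.card = 3) (hdeg : ∀ x, (T.filter fun A => x ∈ A).card ≤ n)
    (𝓗 : Finset (Finset X))
    (h𝓗 : ∑ H ∈ 𝓗, Real.exp (-(1 / 512) * (H.card : ℝ) / Real.sqrt n) ≤ 1 / 2) :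
    ∃ S : Finset X, (∀ A ∈ T, ¬ A ⊆ S) ∧ ∀ H ∈ 𝓗, (S ∩ H).Nonempty := by
  classical
  have hn' : (1 : ℝ) ≤ n := by exact_mod_cast hn
  have hsq : 1 ≤ Real.sqrt n := Real.one_le_sqrt.2 hn'
  have hs0 : 0 < Real.sqrt n := by linarith
  set p : ℝ := 1 / (16 * Real.sqrt n) with hpdef
  have hp : 0 < p := by positivity
  have hp1 : p ≤ 1 := by
    rw [hpdef, div_le_one (by positivity)]; linarith
  have hnp : (n : ℝ) * p ^ 2 = 1 / 256 := by
    rw [hpdef, div_pow, mul_pow, Real.sq_sqrt (by positivity)]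
    field_simp
    norm_num
  set K : Finset X → ℕ := fun H => ⌈p * H.card / 16⌉₊
  set small : Finset X → Finset (Finset X) := fun H =>
    univ.filter fun S => ((S ∩ H).card : ℝ) ≤ p * H.card / 4
  set crowded : Finset X → Finset (Finset X) := fun H =>
    univ.filter fun S => ∃ F ⊆ T.filter fun A => (A ∩ H).Nonempty, F.card = K H ∧
      (F : Set (Finset X)).PairwiseDisjoint id ∧ ∀ A ∈ F, A ⊆ S
  have hw := bernoulliWeight_nonneg (X := X) hp.le hp1
  have hbad : ∀ H ∈ 𝓗, ∑ S ∈ small H ∪ crowded H, bernoulliWeight p S ≤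
      Real.exp (-(1 / 512) * (H.card : ℝ) / Real.sqrt n) := by
    intro H hH
    set y := Real.exp (-(1 / 512) * (H.card : ℝ) / Real.sqrt n)
    have hy : y ≤ 1 / 2 := le_trans
      (single_le_sum (f := fun H : Finset X =>
        Real.exp (-(1 / 512) * (H.card : ℝ) / Real.sqrt n)) (fun _ _ => (Real.exp_pos _).le) hH) h𝓗
    -- p|H|/16 = |H|/(256√n) is twice the exponent in y. Each bad event thus costs at most y², and
    -- 2y² ≤ y because y ≤ 1/2.
    have hyy : Real.exp (-(p * H.card / 16)) = y * y := by
      rw [← Real.exp_add, hpdef]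
      congr 1
      field_simp
      ring
    have h1 : ∑ S ∈ small H, bernoulliWeight p S ≤ y * y :=
      hyy ▸ sum_bernoulliWeight_inter_small_le hp.le hp1 H
    have h2 : ∑ S ∈ crowded H, bernoulliWeight p S ≤ y * y := by
      rw [← hyy]
      refine le_trans ?_ (mul_pow_div_factorial_le hp hnp (card_filter_meeting_le T hdeg H)
        (Nat.le_ceil (p * H.card / 16)))
      convert sum_bernoulliWeight_disjoint_triples_le hp.le hp1
        (T.filter fun A => (A ∩ H).Nonempty) (fun A hA => hT A (filter_subset _ _ hA)) (K H)
    have h3 : ∑ S ∈ small H ∪ crowded H, bernoulliWeight p S ≤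
        ∑ S ∈ small H, bernoulliWeight p S + ∑ S ∈ crowded H, bernoulliWeight p S := by
      rw [← sum_union_inter]
      exact le_add_of_nonneg_right (sum_nonneg fun S _ => hw S)
    have hy0 : 0 < y := Real.exp_pos _
    nlinarith
  obtain ⟨S, hS⟩ : ∃ S, S ∉ 𝓗.biUnion fun H => small H ∪ crowded H := by
    by_contra! hall
    have h1 := sum_bernoulliWeight (X := X) p
    rw [← eq_univ_iff_forall.2 hall] at h1
    have h2 := (sum_biUnion_le hw 𝓗 fun H => small H ∪ crowded H).trans (sum_le_sum hbad)
    linarith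
  have hS' : ∀ H ∈ 𝓗, S ∉ small H ∧ S ∉ crowded H := by
    intro H hH
    rw [← not_or, ← mem_union]
    exact fun h => hS (mem_biUnion.2 ⟨H, hH, h⟩)
  obtain ⟨S', -, hind, hhit⟩ := exists_independent_subset_hitting T hT S 𝓗 K
    (fun H hH => by
      have h1 : p * H.card / 4 < ((S ∩ H).card : ℝ) := by
        simpa [small] using (hS' H hH).1
      have h2 : (K H : ℝ) < p * H.card / 16 + 1 := Nat.ceil_lt_add_one (by positivity)
      have h4 : (0 : ℝ) ≤ p * H.card := by positivity
      rcases Nat.eq_zero_or_pos (K H) with h0 | h0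
      · rw [h0]
        have : (0 : ℝ) < (S ∩ H).card := by linarith
        exact_mod_cast this
      -- 3(K - 1) < 3p|H|/16 ≤ p|H|/4 < |S ∩ H|.
      · have h3 : (3 : ℝ) * ((K H : ℝ) - 1) < (S ∩ H).card := by linarith
        rw [← Nat.cast_pred h0] at h3
        exact_mod_cast h3)
    (fun H hH h => (hS' H hH).2 (mem_filter.2 ⟨mem_univ _, h⟩))
  exact ⟨S', hind, hhit⟩

end Triples

/-! ### Triangles as triples of edges; transfer to graphs and the threshold -/

section Triangles

variable {n : ℕ}

/-- The edges of the complete graph on `U`. -/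
def cliqueEdges (U : Finset (Fin n)) : Finset (CompleteEdge n) :=
  univ.filter fun e => ∀ v ∈ e.1, v ∈ U

theorem card_cliqueEdges (U : Finset (Fin n)) : (cliqueEdges U).card = U.card.choose 2 := by
  rw [← Sym2.card_image_offDiag, ← card_image_of_injective _ Subtype.val_injective]
  congr 1
  ext e
  induction e with
  | _ a b =>
    simp only [cliqueEdges, mem_image, mem_filter, mem_univ, true_and, Subtype.exists, mem_offDiag,
      Prod.exists, exists_and_right, exists_eq_right]
    constructor
    · rintro ⟨hab, h⟩
      exact ⟨a, b, ⟨h a (Sym2.mem_mk_left a b), h b (Sym2.mem_mk_right a b), by simpa using hab⟩, rfl⟩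
    · rintro ⟨c, d, ⟨hc, hd, hcd⟩, h⟩
      rw [← show s(c, d) = s(a, b) from h]
      refine ⟨by simpa using hcd, ?_⟩
      simp [hc, hd]

/-- The edge sets of triangles in the complete graph. -/
def triangleEdgeSets (n : ℕ) : Finset (Finset (CompleteEdge n)) :=
  (univ.powersetCard 3).image cliqueEdges

theorem card_of_mem_triangleEdgeSets {A : Finset (CompleteEdge n)}
    (hA : A ∈ triangleEdgeSets n) : A.card = 3 := by
  obtain ⟨U, hU, rfl⟩ := mem_image.1 hA
  rw [card_cliqueEdges, (mem_powersetCard.1 hU).2]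
  rfl

/-- A triangle through e is determined by its third vertex. -/
theorem card_triangleEdgeSets_containing_le (e : CompleteEdge n) :
    ((triangleEdgeSets n).filter fun A => e ∈ A).card ≤ n := by
  have hsub : ((triangleEdgeSets n).filter fun A => e ∈ A) ⊆
      (univ : Finset (Fin n)).image fun v => cliqueEdges (e.1.toFinset ∪ {v}) := by
    intro A hA
    obtain ⟨hAT, heA⟩ := mem_filter.1 hA
    obtain ⟨U, hU, rfl⟩ := mem_image.1 hAT
    have heU : e.1.toFinset ⊆ U := fun v hv =>
      (mem_filter.1 heA).2 v (Sym2.mem_toFinset.1 hv)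
    have hcard : (U \ e.1.toFinset).card = 1 := by
      rw [card_sdiff_of_subset heU, (mem_powersetCard.1 hU).2, Sym2.card_toFinset_of_not_isDiag _ e.2]
    obtain ⟨v, hv⟩ := card_eq_one.1 hcard
    exact mem_image.2 ⟨v, mem_univ _, by rw [← hv, union_sdiff_of_subset heU]⟩
  exact (card_le_card hsub).trans (card_image_le.trans (by simp))

/-- The graph on `[n]` with a given edge set. -/
def graphOfEdges (S : Finset (CompleteEdge n)) : SimpleGraph (Fin n) :=
  SimpleGraph.fromEdgeSet {e : Sym2 (Fin n) | ∃ h : ¬ e.IsDiag, (⟨e, h⟩ : CompleteEdge n) ∈ S}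

theorem graphOfEdges_cliqueFree {S : Finset (CompleteEdge n)}
    (hS : ∀ A ∈ triangleEdgeSets n, ¬ A ⊆ S) : (graphOfEdges S).CliqueFree 3 := by
  intro U hU
  refine hS (cliqueEdges U) (mem_image.2 ⟨U, mem_powersetCard.2 ⟨subset_univ _, hU.card_eq⟩, rfl⟩) ?_
  rintro ⟨e, he⟩ heU
  induction e with
  | _ a b =>
    have hU' := (mem_filter.1 heU).2
    have hab : a ≠ b := by simpa using he
    have hadj := hU.isClique (hU' a (Sym2.mem_mk_left a b)) (hU' b (Sym2.mem_mk_right a b)) hab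
    obtain ⟨⟨_, h⟩, _⟩ := (SimpleGraph.fromEdgeSet_adj _).1 hadj
    exact h

/-- Each sufficiently sparse collection of edge sets is hit by some triangle-free graph. -/
theorem exists_triangleFree_hitting (hn : 1 ≤ n) (𝓗 : Finset (Finset (CompleteEdge n)))
    (h𝓗 : ∑ H ∈ 𝓗, Real.exp (-(1 / 512) * (H.card : ℝ) / Real.sqrt n) ≤ 1 / 2) :
    ∃ S ∈ triangleFreeFamily n, ∀ H ∈ 𝓗, (S ∩ H).Nonempty := by
  obtain ⟨S, hS, hhit⟩ := exists_independent_hitting hn (triangleEdgeSets n)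
    (fun A hA => card_of_mem_triangleEdgeSets hA) card_triangleEdgeSets_containing_le 𝓗 h𝓗
  exact ⟨S, graphOfEdges_cliqueFree hS, hhit⟩

open scoped Classical in
/-- The edge set of a graph on `[n]`, as a set of edges of the complete graph. -/
noncomputable def completeEdges (H : SimpleGraph (Fin n)) : Finset (CompleteEdge n) :=
  univ.filter fun e => e.1 ∈ H.edgeSet

theorem card_completeEdges (H : SimpleGraph (Fin n)) : (completeEdges H).card = edgeCount H := by
  classical
  rw [edgeCount, ← card_image_of_injective _ Subtype.val_injective, ← Set.ncard_coe_finset]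
  congr 1
  ext e
  simpa [completeEdges] using fun he : e ∈ H.edgeSet => H.not_isDiag_of_mem_edgeSet he

theorem completeEdges_injective : Function.Injective (completeEdges (n := n)) := by
  intro H H' h
  have hsub : ∀ {H H' : SimpleGraph (Fin n)}, completeEdges H = completeEdges H' →
      ∀ e ∈ H.edgeSet, e ∈ H'.edgeSet := by
    intro H H' h e he
    have : (⟨e, H.not_isDiag_of_mem_edgeSet he⟩ : CompleteEdge n) ∈ completeEdges H := by
      simpa [completeEdges] using he
    rw [h] at this
    simpa [completeEdges] using this
  exact SimpleGraph.edgeSet_injective (Set.ext fun e => ⟨hsub h e, hsub h.symm e⟩)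

theorem exp_neg_two_mul_le_one_sub {p : ℝ} (hp : 0 ≤ p) (hp' : p ≤ 1 / 2) :
    Real.exp (-(2 * p)) ≤ 1 - p := by
  rw [Real.exp_neg, inv_le_comm₀ (Real.exp_pos _) (by linarith)]
  refine le_trans ?_ (Real.add_one_le_exp (2 * p))
  rw [inv_le_iff_one_le_mul₀ (by linarith)]
  nlinarith

/-- S lies in T exactly when S misses the complement of T, so a triangle-free S hitting all
complements refutes the certificate. The bound 1 - p ≥ e^(-2p) halves the constant 1/512. -/
theorem le_of_isDownSmall_triangleFreeFamily (hn : 1 ≤ n) {p : ℝ} (hp : 0 ≤ p)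
    (hsmall : IsDownSmall (triangleFreeFamily n) p) : 1 / 1024 / Real.sqrt n ≤ p := by
  by_contra! hlt
  obtain ⟨𝓖, hcover, hsum⟩ := hsmall
  have hsq : 1 ≤ Real.sqrt n := Real.one_le_sqrt.2 (by exact_mod_cast hn)
  have hhalf : p ≤ 1 / 2 := by
    have : 1 / 1024 / Real.sqrt n ≤ 1 / 1024 := div_le_self (by norm_num) hsq
    linarith
  obtain ⟨S, hS, hhit⟩ := exists_triangleFree_hitting hn (𝓖.image compl) (by
    rw [sum_image fun _ _ _ _ h => compl_injective h]
    refine le_trans (sum_le_sum fun S _ => ?_) hsum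
    calc Real.exp (-(1 / 512) * ((Sᶜ).card : ℝ) / Real.sqrt n)
        ≤ Real.exp ((Sᶜ).card * -(2 * p)) := by
          refine Real.exp_le_exp.2 ?_
          have : ((Sᶜ).card : ℝ) * p ≤ (Sᶜ).card * (1 / 1024 / Real.sqrt n) := by gcongr
          calc -(1 / 512) * ((Sᶜ).card : ℝ) / Real.sqrt n
              = -(2 * ((Sᶜ).card * (1 / 1024 / Real.sqrt n))) := by ring
            _ ≤ (Sᶜ).card * -(2 * p) := by linarith
      _ = Real.exp (-(2 * p)) ^ (Sᶜ).card := Real.exp_nat_mul _ _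
      _ ≤ (1 - p) ^ (Sᶜ).card :=
          pow_le_pow_left₀ (Real.exp_pos _).le (exp_neg_two_mul_le_one_sub hp hhalf) _)
  obtain ⟨T, hT, hST⟩ := hcover S hS
  obtain ⟨e, he⟩ := hhit Tᶜ (mem_image_of_mem _ hT)
  obtain ⟨heS, heT⟩ := mem_inter.1 he
  exact mem_compl.1 heT (hST heS)

end Triangles

theorem univ_notMem_triangleFreeFamily {n : ℕ} (hn : 3 ≤ n) :
    (univ : Finset (CompleteEdge n)) ∉ triangleFreeFamily n := by
  intro h
  obtain ⟨U, -, hU⟩ := exists_subset_card_eq (s := (univ : Finset (Fin n))) (n := 3) (by simpa)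
  refine h U (⟨fun a _ b _ hab => ?_, hU⟩)
  exact (SimpleGraph.fromEdgeSet_adj _).2 ⟨⟨by simpa using hab, mem_univ _⟩, hab⟩

theorem theorem2 :
    (∃ δ : ℝ, 0 < δ ∧ ∃ n₀ : ℕ, ∀ n : ℕ, n₀ ≤ n →
      ∀ 𝓗 : Finset (SimpleGraph (Fin n)),
        ∑ H ∈ 𝓗, Real.exp (-δ * (edgeCount H : ℝ) / Real.sqrt (n : ℝ)) < 1 / 2 →
        ∃ G : SimpleGraph (Fin n), G.CliqueFree 3 ∧
          ∀ H ∈ 𝓗, ∃ u v : Fin n, G.Adj u v ∧ H.Adj u v) ∧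
    (∃ c : ℝ, 0 < c ∧ ∃ n₀ : ℕ, ∀ n : ℕ, n₀ ≤ n →
      c / Real.sqrt (n : ℝ) ≤ downExpectationThreshold (triangleFreeFamily n)) := by
  classical
  refine ⟨⟨1 / 512, by norm_num, 1, fun n hn 𝓗 h𝓗 => ?_⟩,
    ⟨1 / 1024, by norm_num, 3, fun n hn => ?_⟩⟩
  · obtain ⟨S, hS, hhit⟩ := exists_triangleFree_hitting hn (𝓗.image completeEdges) (by
      rw [sum_image fun _ _ _ _ h => completeEdges_injective h]
      simpa only [card_completeEdges] using h𝓗.le)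
    refine ⟨graphOfEdges S, hS, fun H hH => ?_⟩
    obtain ⟨⟨e, hdiag⟩, he⟩ := hhit _ (mem_image_of_mem _ hH)
    obtain ⟨heS, heH⟩ := mem_inter.1 he
    induction e with
    | _ u v =>
      exact ⟨u, v, (SimpleGraph.fromEdgeSet_adj _).2 ⟨⟨hdiag, heS⟩, by simpa using hdiag⟩,
        by simpa [completeEdges] using heH⟩
  -- For n ≥ 3 the complete graph has a triangle, so the infimum is attained and the bound applies
  -- to it directly.
  · have hleast := isLeast_downExpectationThreshold _ (univ_notMem_triangleFreeFamily hn)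
    exact le_of_isDownSmall_triangleFreeFamily (by omega) hleast.1.1.1 hleast.1.2
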